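/- For $r>0$ let $f_r(x)=\dfrac{\log(1+rx)}{\log(1+x)}$, $x>0$. Then: (a) if $0<r<1$, $f_r$ is a complete Bernstein function, and in particular a Bernstein function (as conjectured by Bradley); (b) if $r>1$, $f_r$ is a Stieltjes function. Here a *Bernstein function* is a $C^\infty$-function $f:(0,\infty)\to[0,\infty)$ with $(-1)^{n-1}f^{(n)}(x)\ge 0$ for all $x>0$ and $n=1,2,\ldots$. A *complete Bernstein function* is a Bernstein function of the form $f(x)=a+bx+\int_0^\infty(1-e^{-xs})\,m(s)\,ds$, $x>0$, where $a,b\ge 0$ and $m$ is a completely monotone function on $(0,\infty)$ (that is, $m$ is $C^\infty$ and $(-1)^n m^{(n)}\ge 0$ on $(0,\infty)$ for $n=0,1,2,\ldots$) with $\int_0^\infty \min(1,s)\,m(s)\,ds<\infty$. A *Stieltjes function* is a function $f:(0,\infty)\to[0,\infty)$ of the form $f(x)=c+\int_{[0,\infty)}\frac{d\mu(t)}{x+t}$, $x>0$, where $c\ge 0$ and $\mu$ is a positive Borel measure on $[0,\infty)$ such that the integral converges for all $x>0$. -/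

import Mathlib

open Set MeasureTheory
open scoped ContDiff

/-- Bernstein functions: smooth functions `f : (0, ∞) → [0, ∞)` with
`(-1)^(n-1) f^(n) ≥ 0` on `(0, ∞)` for all `n ≥ 1`. Only the values on `(0, ∞)` matter. -/
def IsBernstein (f : ℝ → ℝ) : Prop :=
  ContDiffOn ℝ ∞ f (Ioi 0) ∧ (∀ x : ℝ, 0 < x → 0 ≤ f x) ∧
    ∀ n : ℕ, 1 ≤ n → ∀ x : ℝ, 0 < x → 0 ≤ (-1 : ℝ) ^ (n - 1) * iteratedDeriv n f x

/-- Completely monotone functions on `(0, ∞)`: smooth functions with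
`(-1)^n m^(n) ≥ 0` on `(0, ∞)` for all `n ≥ 0`. -/
def IsCompletelyMonotone (m : ℝ → ℝ) : Prop :=
  ContDiffOn ℝ ∞ m (Ioi 0) ∧
    ∀ n : ℕ, ∀ s : ℝ, 0 < s → 0 ≤ (-1 : ℝ) ^ n * iteratedDeriv n m s

/-- Complete Bernstein functions: Bernstein functions whose Lévy measure has a completely
monotone density `m` with respect to Lebesgue measure on `(0, ∞)`, that is,
`f(x) = a + b x + ∫_(0,∞) (1 - e^(-x s)) m(s) ds` for `x > 0`, with `a, b ≥ 0`
and `∫_(0,∞) min(1, s) m(s) ds < ∞`. -/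
def IsCompleteBernstein (f : ℝ → ℝ) : Prop :=
  IsBernstein f ∧
    ∃ (a b : ℝ) (m : ℝ → ℝ), 0 ≤ a ∧ 0 ≤ b ∧ IsCompletelyMonotone m ∧
      IntegrableOn (fun s : ℝ => min 1 s * m s) (Ioi 0) ∧
      ∀ x : ℝ, 0 < x →
        f x = a + b * x + ∫ s in Ioi (0 : ℝ), (1 - Real.exp (-(x * s))) * m s

/-- Stieltjes functions: `f(x) = c + ∫_[0,∞) dμ(t) / (x + t)` for `x > 0`, where `c ≥ 0` and
`μ` is a positive Borel measure on `[0, ∞)` for which the integral converges for all `x > 0`.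
(The part of `μ` outside `[0, ∞)` is not used.) -/
def IsStieltjes (f : ℝ → ℝ) : Prop :=
  ∃ (c : ℝ) (μ : Measure ℝ), 0 ≤ c ∧
    ∀ x : ℝ, 0 < x →
      IntegrableOn (fun t : ℝ => 1 / (x + t)) (Ici 0) μ ∧
      f x = c + ∫ t in Ici (0 : ℝ), 1 / (x + t) ∂μ

/-- The function `f_r(x) = log(1 + r x) / log(1 + x)`, considered for `x > 0`. -/
noncomputable def logRatio (r : ℝ) (x : ℝ) : ℝ :=
  Real.log (1 + r * x) / Real.log (1 + x)

/-! Both parts come from one integral representation. For a, b in (0, 1], the function log(1 +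
aw)/log(1 + bw) is holomorphic off the cut (-∞, -1], with value a/b at w = 0. The Koebe map carries
the unit disc onto this slit plane, so the cut becomes the circle and the positive axis becomes the
radius (0, 1). A Schwarz formula on the disc (`re_sub_re_eq_integral_boundary_im`) recovers the
function on that radius from the imaginary part of its boundary values. With w = -t on the cut, the
kernel becomes x/(x + t), and `log_div_log_representation` follows: the quotient is a/b plus the
integral of x/(x + t) against a signed density on t > 1.

The sign of the density is that of Im(log(1 - at)/log(1 - bt)) on the upper side of the cut. It is
constant, by comparing arguments and moduli (`log_ofReal_cross_nonneg`): nonnegative for b = 1,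
nonpositive for a = 1. Fatou's lemma and an a priori bound on the quotient make the resulting
positive measure κ finite.

For r < 1 take (a, b) = (r, 1): f = r + ∫ x/(x + t) dκ, and x/(x + t) = ∫ (1 - e^(-xs)) t e^(-st) ds
gives the completely monotone density m(s) = ∫ t e^(-st) dκ. For r > 1 take (a, b) = (1, 1/r) at rx:
f = r - ∫ x/(x + t) dκ = (r - κ(ℝ)) + ∫ t/(x + t) dκ, where f ≥ 0 as x → ∞ forces κ(ℝ) ≤ r. -/

/-! ### A Schwarz formula on the unit disc from dominated radial limits. -/

/-- The Schwarz-type kernel `p / (z - p) - p z / (1 - p z)`, purely imaginary on the unit circle. -/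
noncomputable def discKernel (p : ℝ) (z : ℂ) : ℂ := p / (z - p) - p * z / (1 - p * z)

-- Since p/(z - p) = z/(z - p) - 1 and dz = iz dθ, the integral splits into Cauchy's formula at p,
-- Cauchy's formula at 0, and a term with its pole at 1/p outside the disc. That last term
-- contributes nothing; it is there to make the kernel imaginary on the unit circle.
open Complex in
theorem integral_mul_discKernel {F : ℂ → ℂ} (hF : DifferentiableOn ℂ F (Metric.ball 0 1))
    {p R : ℝ} (hp : 0 < p) (hpR : p < R) (hR : R < 1) :
    ∫ θ in (0 : ℝ)..2 * Real.pi, F (circleMap 0 R θ) * discKernel p (circleMap 0 R θ)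
      = 2 * Real.pi * (F p - F 0) := by
  have hR0 : 0 < R := hp.trans hpR
  have hsub : Metric.closedBall (0 : ℂ) R ⊆ Metric.ball 0 1 := Metric.closedBall_subset_ball hR
  have hc : ContinuousOn F (Metric.closedBall 0 R) := hF.continuousOn.mono hsub
  have hd : ∀ x ∈ Metric.ball (0 : ℂ) R \ ∅, DifferentiableAt ℂ F x := fun x hx =>
    hF.differentiableAt (Metric.isOpen_ball.mem_nhds (hsub (Metric.ball_subset_closedBall hx.1)))
  have hden : ∀ z ∈ Metric.closedBall (0 : ℂ) R, 1 - (p : ℂ) * z ≠ 0 := by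
    intro z hz h
    have hz' : ‖z‖ ≤ R := by simpa using hz
    have h1 : (p : ℂ) * z = 1 := (sub_eq_zero.mp h).symm
    have h2 : ‖(p : ℂ) * z‖ = p * ‖z‖ := by
      rw [norm_mul, Complex.norm_real, Real.norm_of_nonneg hp.le]
    rw [h1, norm_one] at h2
    nlinarith [norm_nonneg z]
  have e1 := circleIntegral_sub_inv_smul_of_differentiable_on_off_countable
    countable_empty (w := (p : ℂ)) (by simpa [abs_of_pos hp] using hpR) hc hd
  have e2 := circleIntegral_sub_inv_smul_of_differentiable_on_off_countable
    countable_empty (w := (0 : ℂ)) (by simpa using hR0) hc hd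
  have hdiv : ∀ z ∈ Metric.closedBall (0 : ℂ) R,
      DifferentiableAt ℂ (fun z : ℂ => (p : ℂ) / (1 - p * z)) z := fun z hz =>
    (differentiableAt_const _).div (by fun_prop) (hden z hz)
  have hc3 : ContinuousOn (fun z => (p : ℂ) / (1 - p * z) * F z) (Metric.closedBall 0 R) :=
    ContinuousOn.mul (fun z hz => (hdiv z hz).continuousAt.continuousWithinAt) hc
  have e3 := circleIntegral_eq_zero_of_differentiable_on_off_countable hR0.le
    (c := (0 : ℂ)) countable_empty hc3
    (fun z hz => (hdiv z (Metric.ball_subset_closedBall hz.1)).mul (hd z hz))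
  have hcm : ∀ θ, circleMap 0 R θ ≠ 0 := fun θ => circleMap_ne_center hR0.ne'
  have hcp : ∀ θ, circleMap 0 R θ - p ≠ 0 := by
    intro θ h
    have h1 := norm_circleMap_zero R θ
    rw [sub_eq_zero.mp h, Complex.norm_real, Real.norm_of_nonneg hp.le, abs_of_pos hR0] at h1
    exact hpR.ne h1
  have hcc : Continuous fun θ => F (circleMap 0 R θ) :=
    hc.comp_continuous (continuous_circleMap 0 R) (fun θ => circleMap_mem_closedBall _ hR0.le θ)
  have hd1 : ∀ θ, 1 - (p : ℂ) * circleMap 0 R θ ≠ 0 := fun θ =>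
    hden _ (circleMap_mem_closedBall _ hR0.le θ)
  simp only [circleIntegral, deriv_circleMap, smul_eq_mul] at e1 e2 e3
  have i1 : IntervalIntegrable (fun θ => circleMap 0 R θ * I *
      ((circleMap 0 R θ - p)⁻¹ * F (circleMap 0 R θ))) volume 0 (2 * Real.pi) := by
    apply Continuous.intervalIntegrable
    have := Continuous.inv₀ (by fun_prop) hcp
    have hcm' : Continuous (circleMap 0 R) := continuous_circleMap 0 R
    exact (hcm'.mul continuous_const).mul (this.mul hcc)
  have i2 : IntervalIntegrable (fun θ => circleMap 0 R θ * I *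
      ((circleMap 0 R θ - 0)⁻¹ * F (circleMap 0 R θ))) volume 0 (2 * Real.pi) := by
    apply Continuous.intervalIntegrable
    have := Continuous.inv₀ (f := fun θ => circleMap 0 R θ - 0) (by fun_prop) (by simpa using hcm)
    have hcm' : Continuous (circleMap 0 R) := continuous_circleMap 0 R
    exact (hcm'.mul continuous_const).mul (this.mul hcc)
  have i3 : IntervalIntegrable (fun θ => circleMap 0 R θ * I *
      ((p : ℂ) / (1 - p * circleMap 0 R θ) * F (circleMap 0 R θ))) volume 0 (2 * Real.pi) := by
    apply Continuous.intervalIntegrable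
    have := Continuous.div (f := fun _ => (p : ℂ)) (by fun_prop) (by fun_prop) hd1
    have hcm' : Continuous (circleMap 0 R) := continuous_circleMap 0 R
    exact (hcm'.mul continuous_const).mul (this.mul hcc)
  have key := intervalIntegral.integral_sub (i1.sub i2) i3
  rw [intervalIntegral.integral_sub i1 i2, e1, e2, e3] at key
  have : ∫ θ in (0 : ℝ)..2 * Real.pi, F (circleMap 0 R θ) * discKernel p (circleMap 0 R θ)
      = -I * (2 * Real.pi * I * F p - 2 * Real.pi * I * F 0 - 0) := by
    rw [← key, ← intervalIntegral.integral_const_mul]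
    refine intervalIntegral.integral_congr fun θ _ => ?_
    have h1 := hcm θ
    have h2 := hcp θ
    have h3 := hd1 θ
    simp only [discKernel, sub_zero]
    generalize circleMap 0 R θ = z at *
    field_simp
    ring_nf
    simp only [I_sq]
    ring
  rw [this]
  linear_combination (-2 * Real.pi * (F p - F 0)) * I_sq

open Complex in
theorem integral_zero_two_pi_of_conj_symm {g : ℝ → ℂ} (hg : Continuous g)
    (hsymm : ∀ θ, g (2 * Real.pi - θ) = starRingEnd ℂ (g θ)) :
    ∫ θ in (0 : ℝ)..2 * Real.pi, g θ = 2 * ((∫ θ in (0 : ℝ)..Real.pi, (g θ).re : ℝ) : ℂ) := by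
  have h := intervalIntegral.integral_add_adjacent_intervals
    (hg.intervalIntegrable (μ := volume) 0 Real.pi) (hg.intervalIntegrable Real.pi (2 * Real.pi))
  have h2 : ∫ θ in Real.pi..2 * Real.pi, g θ = ∫ θ in (0 : ℝ)..Real.pi, starRingEnd ℂ (g θ) := by
    simp_rw [← hsymm]
    rw [intervalIntegral.integral_comp_sub_left (fun x => g x)]
    congr 1 <;> ring
  rw [← h, h2, ← intervalIntegral.integral_add (hg.intervalIntegrable _ _)
    ((show Continuous fun θ => starRingEnd ℂ (g θ) from continuous_conj.comp hg).intervalIntegrable _ _), ← intervalIntegral.integral_ofReal,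
    ← intervalIntegral.integral_const_mul]
  refine intervalIntegral.integral_congr fun θ _ => ?_
  simp [Complex.add_conj]

open Complex in
theorem discKernel_circleMap_one (p θ : ℝ) (hp : |p| < 1) :
    discKernel p (circleMap 0 1 θ) =
      -(2 * p * Real.sin θ / (1 - 2 * p * Real.cos θ + p ^ 2) : ℝ) * I := by
  have hz : circleMap 0 1 θ = Real.cos θ + Real.sin θ * I := by
    simp [circleMap, Complex.exp_mul_I]
  have hne : (1 - 2 * p * Real.cos θ + p ^ 2) ≠ 0 := by
    have h1 := abs_lt.mp hp
    have : 0 < (1 - 2 * p * Real.cos θ + p ^ 2) := by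
      have := Real.sin_sq_add_cos_sq θ
      have h3 : (1 - 2 * p * Real.cos θ + p ^ 2) = (p - Real.cos θ) ^ 2 + Real.sin θ ^ 2 := by
        linarith
      rcases eq_or_ne p (Real.cos θ) with h | h
      · rw [← h] at this
        nlinarith
      · have := sq_pos_of_ne_zero (sub_ne_zero.mpr h)
        nlinarith [sq_nonneg (Real.sin θ)]
    exact this.ne'
  have hcs : ((Real.cos θ : ℝ) : ℂ) ^ 2 + ((Real.sin θ : ℝ) : ℂ) ^ 2 = 1 := by
    exact_mod_cast Real.cos_sq_add_sin_sq θ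
  have hne' : (1 - 2 * (p : ℂ) * (Real.cos θ : ℝ) + p ^ 2) ≠ 0 := by exact_mod_cast hne
  rw [discKernel, hz]
  push_cast [-Complex.ofReal_cos, -Complex.ofReal_sin]
  generalize ((Real.cos θ : ℝ) : ℂ) = c at *
  generalize ((Real.sin θ : ℝ) : ℂ) = s at *
  have hprod : (c + s * I - p) * (c - s * I - p) = 1 - 2 * p * c + p ^ 2 := by
    linear_combination hcs - s ^ 2 * I_sq
  have h1 : c + s * I - p ≠ 0 := fun h => hne' (by rw [← hprod, h, zero_mul])
  have h2 : 1 - p * (c + s * I) ≠ 0 := by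
    intro h
    have : (1 - p * (c + s * I)) * (1 - p * (c - s * I)) = 1 - 2 * p * c + p ^ 2 := by
      linear_combination (p : ℂ) ^ 2 * hcs - p ^ 2 * s ^ 2 * I_sq
    exact hne' (by rw [← this, h, zero_mul])
  rw [div_sub_div _ _ h1 h2, eq_comm, neg_mul, div_mul_eq_mul_div, ← neg_div,
    div_eq_div_iff hne' (mul_ne_zero h1 h2)]
  have hzw : (c + s * I) * (c - s * I) = 1 := by linear_combination hcs - s ^ 2 * I_sq
  linear_combination (p * (1 + p ^ 2 - 2 * p * (c + s * I)) : ℂ) * hzw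

-- The radius (1 + p)/2 is halfway from p to the circle, so |z - p| ≥ (1 - p)/2. This gives a bound
-- independent of R for dominated convergence.
open Complex in
theorem norm_discKernel_le {p R : ℝ} (hp : 0 < p) (hp1 : p < 1) (hR : (1 + p) / 2 ≤ R) (hR1 : R < 1)
    (θ : ℝ) : ‖discKernel p (circleMap 0 R θ)‖ ≤ 2 / (1 - p) + 1 / (1 - p) := by
  have hn : ‖circleMap 0 R θ‖ = R := by
    rw [norm_circleMap_zero, abs_of_pos (by linarith)]
  have hnp : ‖(p : ℂ)‖ = p := by rw [Complex.norm_real, Real.norm_of_nonneg hp.le]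
  generalize circleMap 0 R θ = z at hn
  refine (norm_sub_le _ _).trans (add_le_add ?_ ?_)
  · rw [norm_div, hnp]
    have h1 : R - p ≤ ‖z - p‖ := by
      have := norm_sub_norm_le z (p : ℂ)
      rwa [hn, hnp] at this
    rw [div_le_div_iff₀ (by linarith) (by linarith)]
    nlinarith
  · rw [norm_div, norm_mul, hnp, hn]
    have h1 : 1 - p ≤ ‖1 - p * z‖ := by
      have := norm_sub_norm_le (1 : ℂ) (p * z)
      rw [norm_mul, hnp, hn, norm_one] at this
      nlinarith
    rw [div_le_div_iff₀ (by linarith) (by linarith)]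
    have h2 : p * R ≤ 1 := by nlinarith
    have h3 := mul_le_mul_of_nonneg_right h2 (show 0 ≤ 1 - p by linarith)
    linarith

open Complex Filter Topology in
/-- A conjugation-symmetric holomorphic function on the disc with dominated radial limits is
recovered on the real radius from the imaginary part of its boundary values. -/
theorem re_sub_re_eq_integral_boundary_im {F : ℂ → ℂ}
    (hF : DifferentiableOn ℂ F (Metric.ball 0 1))
    (hconj : ∀ z ∈ Metric.ball (0 : ℂ) 1, F (starRingEnd ℂ z) = starRingEnd ℂ (F z))
    {Fb : ℝ → ℂ} {B : ℝ → ℝ}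
    (hm : AEStronglyMeasurable Fb (volume.restrict (Ioo 0 Real.pi)))
    (hB : IntegrableOn B (Ioo 0 Real.pi))
    (hbound : ∀ R : ℝ, 1 / 2 ≤ R → R < 1 →
      ∀ᵐ θ ∂volume.restrict (Ioo 0 Real.pi), ‖F (circleMap 0 R θ)‖ ≤ B θ)
    (hlim : ∀ᵐ θ ∂volume.restrict (Ioo 0 Real.pi),
      Tendsto (fun R : ℝ => F (circleMap 0 R θ)) (𝓝[<] 1) (𝓝 (Fb θ)))
    {p : ℝ} (hp : 0 < p) (hp1 : p < 1) :
    IntegrableOn (fun θ => (Fb θ).im *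
        (2 * p * Real.sin θ / (1 - 2 * p * Real.cos θ + p ^ 2))) (Ioo 0 Real.pi) ∧
      (F p).re - (F 0).re = 1 / Real.pi * ∫ θ in Ioo 0 Real.pi, (Fb θ).im *
        (2 * p * Real.sin θ / (1 - 2 * p * Real.cos θ + p ^ 2)) := by
  have hpre : ∀ R : ℝ, p < R → R < 1 →
      ∫ θ in Ioo 0 Real.pi, (F (circleMap 0 R θ) * discKernel p (circleMap 0 R θ)).re
        = Real.pi * ((F p).re - (F 0).re) := by
    intro R hpR hR
    have hR0 : 0 < R := hp.trans hpR
    have hmem : ∀ θ, circleMap 0 R θ ∈ Metric.ball (0 : ℂ) 1 := by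
      intro θ; simpa [abs_of_pos hR0] using hR
    have hcm : Continuous (circleMap 0 R) := continuous_circleMap 0 R
    have hn : ∀ θ, ‖circleMap 0 R θ‖ = R := fun θ => by rw [norm_circleMap_zero, abs_of_pos hR0]
    have hnp : ‖(p : ℂ)‖ = p := by rw [Complex.norm_real, Real.norm_of_nonneg hp.le]
    have hcont : Continuous fun θ => F (circleMap 0 R θ) * discKernel p (circleMap 0 R θ) := by
      refine (hF.continuousOn.comp_continuous hcm hmem).mul ?_
      unfold discKernel
      refine (Continuous.div continuous_const (by fun_prop) ?_).sub
        (Continuous.div (by fun_prop) (by fun_prop) ?_)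
      · intro θ h
        have := hn θ
        rw [sub_eq_zero.mp h, hnp] at this
        exact hpR.ne this
      · intro θ h
        have h2 : ‖(p : ℂ) * circleMap 0 R θ‖ = p * R := by rw [norm_mul, hnp, hn]
        rw [← sub_eq_zero.mp h, norm_one] at h2
        nlinarith
    have h := integral_mul_discKernel hF hp hpR hR
    rw [integral_zero_two_pi_of_conj_symm hcont] at h
    · rw [← integral_Ioc_eq_integral_Ioo, ← intervalIntegral.integral_of_le Real.pi_pos.le]
      have h' := congrArg Complex.re h
      simp only [mul_re, ofReal_re, ofReal_im, mul_zero, sub_zero, re_ofNat, im_ofNat, sub_re] at h' ⊢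
      simp at h'
      linarith
    · intro θ
      have hs : circleMap 0 R (2 * Real.pi - θ) = starRingEnd ℂ (circleMap 0 R θ) := by
        simp only [circleMap, map_add, map_mul, conj_ofReal, ← exp_conj, conj_I, map_zero]
        congr 2
        rw [Complex.exp_eq_exp_iff_exists_int]
        exact ⟨1, by push_cast; ring⟩
      rw [hs, hconj _ (hmem θ)]
      simp [discKernel]
  have hker : ∀ θ ∈ Ioo 0 Real.pi, Tendsto (fun R : ℝ => discKernel p (circleMap 0 R θ)) (𝓝[<] 1)
      (𝓝 (discKernel p (circleMap 0 1 θ))) := by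
    intro θ hθ
    have hn : ‖circleMap 0 1 θ‖ = 1 := by simp
    have hnp : ‖(p : ℂ)‖ = p := by rw [Complex.norm_real, Real.norm_of_nonneg hp.le]
    have hc : ContinuousAt (discKernel p) (circleMap 0 1 θ) := by
      unfold discKernel
      refine (ContinuousAt.div (by fun_prop) (by fun_prop) ?_).sub
        (ContinuousAt.div (by fun_prop) (by fun_prop) ?_)
      · intro h
        rw [sub_eq_zero.mp h, hnp] at hn
        exact hp1.ne hn
      · intro h
        have h2 : ‖(p : ℂ) * circleMap 0 1 θ‖ = p := by rw [norm_mul, hnp, hn, mul_one]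
        rw [← sub_eq_zero.mp h, norm_one] at h2
        exact hp1.ne' h2
    refine hc.tendsto.comp (tendsto_nhdsWithin_of_tendsto_nhds ?_)
    have : Continuous fun R : ℝ => circleMap 0 R θ := by unfold circleMap; fun_prop
    exact this.tendsto 1
  have heq : ∀ θ, (Fb θ * discKernel p (circleMap 0 1 θ)).re =
      (Fb θ).im * (2 * p * Real.sin θ / (1 - 2 * p * Real.cos θ + p ^ 2)) := by
    intro θ
    rw [discKernel_circleMap_one p θ (by rw [abs_of_pos hp]; exact hp1)]
    generalize (2 * p * Real.sin θ / (1 - 2 * p * Real.cos θ + p ^ 2)) = k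
    simp
  set C := 2 / (1 - p) + 1 / (1 - p) with hC
  have hC0 : 0 ≤ C := by have : 0 < 1 - p := by linarith
                         positivity
  have hev : ∀ᶠ R in 𝓝[<] (1 : ℝ), (1 + p) / 2 ≤ R ∧ R < 1 := by
    filter_upwards [Ioo_mem_nhdsLT (show (1 + p) / 2 < 1 by linarith)] with R hR
    exact ⟨hR.1.le, hR.2⟩
  have hbd : ∀ R : ℝ, (1 + p) / 2 ≤ R → R < 1 → ∀ᵐ θ ∂volume.restrict (Ioo 0 Real.pi),
      ‖F (circleMap 0 R θ) * discKernel p (circleMap 0 R θ)‖ ≤ B θ * C := by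
    intro R hR hR1
    filter_upwards [hbound R (by linarith) hR1] with θ hθ
    rw [norm_mul]
    exact mul_le_mul hθ (norm_discKernel_le hp hp1 hR hR1 θ) (norm_nonneg _)
      ((norm_nonneg _).trans hθ)
  have hlim' : ∀ᵐ θ ∂volume.restrict (Ioo 0 Real.pi),
      Tendsto (fun R : ℝ => (F (circleMap 0 R θ) * discKernel p (circleMap 0 R θ)).re) (𝓝[<] 1)
        (𝓝 (Fb θ * discKernel p (circleMap 0 1 θ)).re) := by
    filter_upwards [hlim, ae_restrict_mem measurableSet_Ioo] with θ hθ hmem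
    exact (continuous_re.tendsto _).comp (hθ.mul (hker θ hmem))
  have hBC : Integrable (fun θ => B θ * C) (volume.restrict (Ioo 0 Real.pi)) := hB.mul_const C
  -- The exceptional null set of `hbound` depends on R, so the bound passes to the limit along a
  -- sequence of radii, where countably many null sets can be united.
  have hbd0 : ∀ᵐ θ ∂volume.restrict (Ioo 0 Real.pi),
      ‖(Fb θ * discKernel p (circleMap 0 1 θ)).re‖ ≤ B θ * C := by
    have hseq : Tendsto (fun n : ℕ => (1 : ℝ) - (1 - p) / 2 / (n + 1)) atTop (𝓝[<] 1) := by
      refine tendsto_nhdsWithin_iff.mpr ⟨?_, Eventually.of_forall fun n => ?_⟩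
      · simpa using tendsto_const_nhds.sub
          (tendsto_const_nhds.div_atTop
            (tendsto_atTop_add_const_right atTop (1 : ℝ) tendsto_natCast_atTop_atTop))
      · have : 0 < (1 - p) / 2 / ((n : ℝ) + 1) := by
          have : 0 < 1 - p := by linarith
          positivity
        simp only [mem_Iio]; linarith
    have hall : ∀ᵐ θ ∂volume.restrict (Ioo 0 Real.pi), ∀ n : ℕ,
        ‖F (circleMap 0 (1 - (1 - p) / 2 / (n + 1)) θ) *
          discKernel p (circleMap 0 (1 - (1 - p) / 2 / (n + 1)) θ)‖ ≤ B θ * C := by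
      refine ae_all_iff.mpr fun n => hbd _ ?_ ?_
      · have : (1 - p) / 2 / ((n : ℝ) + 1) ≤ (1 - p) / 2 :=
          div_le_self (by linarith) (by linarith [Nat.cast_nonneg (α := ℝ) n])
        linarith
      · have : 0 < (1 - p) / 2 / ((n : ℝ) + 1) := by
          have : 0 < 1 - p := by linarith
          positivity
        linarith
    filter_upwards [hall, hlim'] with θ h1 h2
    refine le_of_tendsto ((h2.comp hseq).norm) (Eventually.of_forall fun n => ?_)
    exact (abs_re_le_norm _).trans (h1 n)
  have hmeas : AEStronglyMeasurable (fun θ => (Fb θ * discKernel p (circleMap 0 1 θ)).re)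
      (volume.restrict (Ioo 0 Real.pi)) := by
    refine continuous_re.comp_aestronglyMeasurable (hm.mul ?_)
    refine Measurable.aestronglyMeasurable ?_
    unfold discKernel
    have : Measurable (circleMap 0 1) := (continuous_circleMap 0 1).measurable
    fun_prop
  have hint : Integrable (fun θ => (Fb θ * discKernel p (circleMap 0 1 θ)).re)
      (volume.restrict (Ioo 0 Real.pi)) := hBC.mono' hmeas hbd0
  have hT := tendsto_integral_filter_of_dominated_convergence (fun θ => B θ * C)
    (l := 𝓝[<] (1 : ℝ)) (μ := volume.restrict (Ioo 0 Real.pi))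
    (F := fun R θ => (F (circleMap 0 R θ) * discKernel p (circleMap 0 R θ)).re)
    (f := fun θ => (Fb θ * discKernel p (circleMap 0 1 θ)).re)
    (by
      filter_upwards [hev] with R hR
      have hR0 : 0 < R := by linarith
      have hmem : ∀ θ, circleMap 0 R θ ∈ Metric.ball (0 : ℂ) 1 := by
        intro θ; simpa [abs_of_pos hR0] using hR.2
      have hcm : Continuous (circleMap 0 R) := continuous_circleMap 0 R
      have h1 : Continuous fun θ => F (circleMap 0 R θ) :=
        hF.continuousOn.comp_continuous hcm hmem
      have h2 := h1.measurable
      have h3 := hcm.measurable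
      refine Measurable.aestronglyMeasurable ?_
      unfold discKernel
      exact measurable_re.comp (h2.mul (by fun_prop)))
    (by
      filter_upwards [hev] with R hR
      filter_upwards [hbd R hR.1 hR.2] with θ hθ
      exact (abs_re_le_norm _).trans hθ)
    hBC hlim'
  have hT2 : Tendsto (fun R : ℝ => ∫ θ in Ioo 0 Real.pi,
      (F (circleMap 0 R θ) * discKernel p (circleMap 0 R θ)).re) (𝓝[<] 1)
      (𝓝 (Real.pi * ((F p).re - (F 0).re))) := by
    refine tendsto_const_nhds.congr' ?_
    filter_upwards [hev] with R hR
    exact (hpre R (by linarith) hR.2).symm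
  have hres := tendsto_nhds_unique hT2 hT
  simp only [heq] at hres hint
  refine ⟨hint, ?_⟩
  rw [← hres]
  field_simp

/-! ### The Koebe map and the quotient of logarithms on the disc. -/

/-- The Koebe function, mapping the unit disc onto `ℂ ∖ (-∞, -1]`. -/
noncomputable def koebe (z : ℂ) : ℂ := 4 * z / (1 - z) ^ 2

theorem one_sub_ne_zero_of_norm_lt {z : ℂ} (hz : ‖z‖ < 1) : 1 - z ≠ 0 := by
  intro h
  rw [← sub_eq_zero.mp h, norm_one] at hz
  exact lt_irrefl _ hz

theorem one_add_koebe {z : ℂ} (hz : 1 - z ≠ 0) : 1 + koebe z = ((1 + z) / (1 - z)) ^ 2 := by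
  unfold koebe
  field_simp
  ring

theorem one_add_div_one_sub_re {z : ℂ} :
    ((1 + z) / (1 - z)).re = (1 - ‖z‖ ^ 2) / ‖1 - z‖ ^ 2 := by
  rw [Complex.div_re, ← add_div, Complex.sq_norm, Complex.sq_norm, Complex.normSq_apply z]
  congr 1
  simp
  ring

theorem one_add_div_one_sub_im {z : ℂ} :
    ((1 + z) / (1 - z)).im = 2 * z.im / ‖1 - z‖ ^ 2 := by
  rw [Complex.div_im, ← sub_div, Complex.sq_norm]
  congr 1
  simp
  ring

theorem one_add_koebe_mem_slitPlane {z : ℂ} (hz : ‖z‖ < 1) : 1 + koebe z ∈ Complex.slitPlane := by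
  have h1 := one_sub_ne_zero_of_norm_lt hz
  rw [one_add_koebe h1]
  have hre : 0 < ((1 + z) / (1 - z)).re := by
    rw [one_add_div_one_sub_re]
    have : 0 < ‖1 - z‖ := norm_pos_iff.mpr h1
    have : 0 < 1 - ‖z‖ ^ 2 := by nlinarith [norm_nonneg z]
    positivity
  generalize (1 + z) / (1 - z) = c at hre
  rw [Complex.mem_slitPlane_iff, pow_two, Complex.mul_re, Complex.mul_im]
  rcases eq_or_ne c.im 0 with h | h
  · left; rw [h]; nlinarith
  · right
    have := mul_ne_zero hre.ne' h
    intro h'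
    apply this
    linarith

theorem koebe_im_nonneg {z : ℂ} (hz : ‖z‖ < 1) (him : 0 ≤ z.im) : 0 ≤ (koebe z).im := by
  have h1 := one_sub_ne_zero_of_norm_lt hz
  have h2 : (koebe z).im = (1 + koebe z).im := by simp
  rw [h2, one_add_koebe h1, pow_two, Complex.mul_im, one_add_div_one_sub_re, one_add_div_one_sub_im]
  have : 0 ≤ 1 - ‖z‖ ^ 2 := by nlinarith [norm_nonneg z]
  positivity

/-- 1 + aw = (1 - a)·1 + a(1 + w), and the slit plane is star-shaped about 1. This is where a ≤ 1 is
needed. -/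
theorem one_add_mul_koebe_mem_slitPlane {a : ℝ} (ha : 0 ≤ a) (ha1 : a ≤ 1) {z : ℂ} (hz : ‖z‖ < 1) :
    1 + a * koebe z ∈ Complex.slitPlane := by
  have := Complex.starConvex_one_slitPlane (one_add_koebe_mem_slitPlane hz)
    (show 0 ≤ 1 - a by linarith) ha (by ring)
  convert this using 1
  simp only [Complex.real_smul]
  push_cast
  ring

/-- The branch of `log (1 + a w)`, `w = koebe z`, on the unit disc. -/
noncomputable def koebeLog (a : ℝ) (z : ℂ) : ℂ := Complex.log (1 + a * koebe z)

theorem koebe_zero : koebe 0 = 0 := by simp [koebe]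

theorem koebeLog_zero (a : ℝ) : koebeLog a 0 = 0 := by simp [koebeLog, koebe_zero]

theorem differentiableAt_koebe {z : ℂ} (hz : 1 - z ≠ 0) : DifferentiableAt ℂ koebe z := by
  unfold koebe
  exact DifferentiableAt.div (by fun_prop) (by fun_prop) (pow_ne_zero 2 hz)

theorem differentiableOn_koebeLog {a : ℝ} (ha : 0 ≤ a) (ha1 : a ≤ 1) :
    DifferentiableOn ℂ (koebeLog a) (Metric.ball 0 1) := by
  intro z hz
  have hz' : ‖z‖ < 1 := by simpa using hz
  have := differentiableAt_koebe (one_sub_ne_zero_of_norm_lt hz')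
  exact (DifferentiableAt.clog (f := fun z => 1 + a * koebe z) (by fun_prop)
    (one_add_mul_koebe_mem_slitPlane ha ha1 hz')).differentiableWithinAt

theorem deriv_koebeLog_zero (a : ℝ) : deriv (koebeLog a) 0 = 4 * a := by
  have h1 : HasDerivAt koebe 4 0 := by
    have := ((hasDerivAt_id (0 : ℂ)).const_mul 4).div
      (((hasDerivAt_id (0 : ℂ)).const_sub 1).pow 2) (by simp)
    have h : HasDerivAt koebe _ 0 := this
    exact h.congr_deriv (by simp)
  have h2 : HasDerivAt (fun z => 1 + (a : ℂ) * koebe z) (a * 4) 0 := (h1.const_mul (a : ℂ)).const_add 1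
  have h3 := h2.clog (by simp [koebe_zero])
  have : deriv (koebeLog a) 0 = (a * 4) / (1 + a * koebe 0) := h3.deriv
  rw [this, koebe_zero]
  simp [mul_comm]

theorem koebeLog_conj {a : ℝ} (ha : 0 ≤ a) (ha1 : a ≤ 1) {z : ℂ} (hz : ‖z‖ < 1) :
    koebeLog a (starRingEnd ℂ z) = starRingEnd ℂ (koebeLog a z) := by
  unfold koebeLog
  rw [← Complex.log_conj _ (Complex.slitPlane_arg_ne_pi (one_add_mul_koebe_mem_slitPlane ha ha1 hz))]
  simp [koebe, show starRingEnd ℂ 4 = 4 from map_ofNat _ 4]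

theorem exp_koebeLog_sub_one {a : ℝ} (ha : 0 ≤ a) (ha1 : a ≤ 1) {z : ℂ} (hz : ‖z‖ < 1) :
    Complex.exp (koebeLog a z) - 1 = a * koebe z := by
  unfold koebeLog
  rw [Complex.exp_log (Complex.slitPlane_ne_zero (one_add_mul_koebe_mem_slitPlane ha ha1 hz))]
  ring

/-- Keeps the denominator of the quotient away from zero. If u is the logarithm and |u| ≤ 1, then
|e^u - 1| ≤ 2|u|, while e^u - 1 = a·koebe z and |koebe z| ≥ |z| because |1 - z| ≤ 2. -/
theorem le_norm_koebeLog {a : ℝ} (ha : 0 ≤ a) (ha1 : a ≤ 1) {z : ℂ} (hz : ‖z‖ < 1) :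
    a * ‖z‖ / 2 ≤ ‖koebeLog a z‖ := by
  rcases le_total ‖koebeLog a z‖ 1 with h | h
  · have h1 := Complex.norm_exp_sub_one_le h
    rw [exp_koebeLog_sub_one ha ha1 hz, norm_mul, Complex.norm_real, Real.norm_of_nonneg ha] at h1
    have h2 : ‖z‖ ≤ ‖koebe z‖ := by
      have h3 : ‖1 - z‖ ≤ 2 := (norm_sub_le _ _).trans (by rw [norm_one]; linarith)
      have h4 : 0 < ‖1 - z‖ := norm_pos_iff.mpr (one_sub_ne_zero_of_norm_lt hz)
      rw [koebe, norm_div, norm_mul, norm_pow, le_div_iff₀ (by positivity)]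
      have : ‖(4 : ℂ)‖ = 4 := by simp
      rw [this]
      have : ‖1 - z‖ ^ 2 ≤ 4 := by nlinarith
      nlinarith [norm_nonneg z]
    have := mul_le_mul_of_nonneg_left h2 ha
    linarith
  · have := mul_le_mul ha1 hz.le (norm_nonneg z) zero_le_one
    linarith

/-- The analytic extension to the disc of `koebeLog a / koebeLog b`. -/
noncomputable def koebeRatio (a b : ℝ) (z : ℂ) : ℂ :=
  dslope (koebeLog a) 0 z / dslope (koebeLog b) 0 z

theorem koebeRatio_of_ne {a b : ℝ} {z : ℂ} (hz : z ≠ 0) :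
    koebeRatio a b z = koebeLog a z / koebeLog b z := by
  rw [koebeRatio, dslope_of_ne _ hz, dslope_of_ne _ hz, slope_def_field, slope_def_field,
    koebeLog_zero, koebeLog_zero, sub_zero, sub_zero, sub_zero, div_div_div_cancel_right₀ hz]

theorem koebeRatio_zero {a b : ℝ} : koebeRatio a b 0 = (a / b : ℝ) := by
  rw [koebeRatio, dslope_same, dslope_same, deriv_koebeLog_zero, deriv_koebeLog_zero,
    mul_div_mul_left _ _ (by norm_num)]
  simp

theorem dslope_koebeLog_ne_zero {b : ℝ} (hb : 0 < b) (hb1 : b ≤ 1) {z : ℂ} (hz : ‖z‖ < 1) :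
    dslope (koebeLog b) 0 z ≠ 0 := by
  rcases eq_or_ne z 0 with rfl | h
  · rw [dslope_same, deriv_koebeLog_zero]
    simp [hb.ne']
  · rw [dslope_of_ne _ h, slope_def_field, koebeLog_zero, sub_zero, sub_zero]
    have : 0 < ‖z‖ := norm_pos_iff.mpr h
    have h1 : 0 < ‖koebeLog b z‖ := lt_of_lt_of_le (by positivity) (le_norm_koebeLog hb.le hb1 hz)
    exact div_ne_zero (norm_pos_iff.mp h1) h

theorem differentiableOn_koebeRatio {a b : ℝ} (ha : 0 ≤ a) (ha1 : a ≤ 1) (hb : 0 < b)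
    (hb1 : b ≤ 1) : DifferentiableOn ℂ (koebeRatio a b) (Metric.ball 0 1) := by
  have h0 : Metric.ball (0 : ℂ) 1 ∈ nhds 0 := Metric.ball_mem_nhds _ one_pos
  exact ((Complex.differentiableOn_dslope h0).mpr (differentiableOn_koebeLog ha ha1)).div
    ((Complex.differentiableOn_dslope h0).mpr (differentiableOn_koebeLog hb.le hb1))
    (fun z hz => dslope_koebeLog_ne_zero hb hb1 (by simpa using hz))

theorem koebeRatio_conj {a b : ℝ} (ha : 0 ≤ a) (ha1 : a ≤ 1) (hb : 0 ≤ b) (hb1 : b ≤ 1) {z : ℂ}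
    (hz : ‖z‖ < 1) : koebeRatio a b (starRingEnd ℂ z) = starRingEnd ℂ (koebeRatio a b z) := by
  rcases eq_or_ne z 0 with rfl | h
  · rw [map_zero, koebeRatio_zero, Complex.conj_ofReal]
  · rw [koebeRatio_of_ne h, koebeRatio_of_ne (by simpa using h), koebeLog_conj ha ha1 hz,
      koebeLog_conj hb hb1 hz, map_div₀]

/-! ### Boundary values on the cut. -/

theorem one_sub_circleMap_sq (θ : ℝ) :
    (1 - circleMap 0 1 θ) ^ 2 = -2 * (1 - Real.cos θ : ℝ) * circleMap 0 1 θ := by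
  have hz : circleMap 0 1 θ = Real.cos θ + Real.sin θ * Complex.I := by
    simp [circleMap, Complex.exp_mul_I]
  have hcs : ((Real.cos θ : ℝ) : ℂ) ^ 2 + ((Real.sin θ : ℝ) : ℂ) ^ 2 = 1 := by
    exact_mod_cast Real.cos_sq_add_sin_sq θ
  rw [hz]
  push_cast [-Complex.ofReal_cos, -Complex.ofReal_sin]
  linear_combination ((Real.sin θ : ℝ) : ℂ) ^ 2 * Complex.I_sq - hcs

theorem one_sub_cos_pos {θ : ℝ} (hθ : θ ∈ Ioo 0 Real.pi) : 0 < 1 - Real.cos θ := by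
  have := Real.cos_lt_cos_of_nonneg_of_le_pi le_rfl hθ.2.le hθ.1
  rw [Real.cos_zero] at this
  linarith

theorem koebe_circleMap_one {θ : ℝ} (hθ : θ ∈ Ioo 0 Real.pi) :
    koebe (circleMap 0 1 θ) = (-(2 / (1 - Real.cos θ)) : ℝ) := by
  have h := one_sub_cos_pos hθ
  have h1 : ((1 - Real.cos θ : ℝ) : ℂ) ≠ 0 := by exact_mod_cast h.ne'
  have h2 : circleMap 0 1 θ ≠ 0 := circleMap_ne_center one_ne_zero
  rw [koebe, one_sub_circleMap_sq]
  push_cast [-Complex.ofReal_sub, -Complex.ofReal_cos]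
  field_simp
  norm_num

theorem one_sub_circleMap_ne_zero {θ : ℝ} (hθ : θ ∈ Ioo 0 Real.pi) : 1 - circleMap 0 1 θ ≠ 0 := by
  have h := one_sub_cos_pos hθ
  have h1 : ((1 - Real.cos θ : ℝ) : ℂ) ≠ 0 := by exact_mod_cast h.ne'
  have h2 : circleMap 0 1 θ ≠ 0 := circleMap_ne_center one_ne_zero
  have h3 := one_sub_circleMap_sq θ
  intro h0
  rw [h0] at h3
  have h4 := mul_ne_zero (mul_ne_zero (show (-2 : ℂ) ≠ 0 by norm_num) h1) h2
  exact h4 (by rw [← h3]; norm_num)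

open Filter Topology in
theorem tendsto_koebeLog_circleMap {a θ : ℝ} (ha : 0 ≤ a) (hθ : θ ∈ Ioo 0 Real.pi)
    (hne : 1 - a * (2 / (1 - Real.cos θ)) ≠ 0) :
    Tendsto (fun R : ℝ => koebeLog a (circleMap 0 R θ)) (𝓝[<] 1)
      (𝓝 (Complex.log (1 - a * (2 / (1 - Real.cos θ)) : ℝ))) := by
  have hc : Continuous fun R : ℝ => circleMap 0 R θ := by unfold circleMap; fun_prop
  have hk : Tendsto (fun R : ℝ => 1 + a * koebe (circleMap 0 R θ)) (𝓝[<] 1)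
      (𝓝 ((1 - a * (2 / (1 - Real.cos θ)) : ℝ) : ℂ)) := by
    have h1 := ((differentiableAt_koebe (one_sub_circleMap_ne_zero hθ)).continuousAt.tendsto).comp
      (hc.tendsto 1)
    rw [koebe_circleMap_one hθ] at h1
    have h2 := (h1.const_mul (a : ℂ)).const_add 1
    refine (tendsto_nhdsWithin_of_tendsto_nhds h2).trans (le_of_eq ?_)
    congr 1
    push_cast
    ring
  unfold koebeLog
  rcases lt_or_gt_of_ne hne with h | h
  -- Here the limit lies on the branch cut of `Complex.log`. The upper half disc maps to Im ≥ 0, the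
  -- side from which the principal logarithm is continuous.
  · have hlog := Complex.continuousWithinAt_log_of_re_neg_of_im_zero
      (z := ((1 - a * (2 / (1 - Real.cos θ)) : ℝ) : ℂ)) (by rwa [Complex.ofReal_re])
      (Complex.ofReal_im _)
    refine hlog.tendsto.comp (tendsto_nhdsWithin_iff.mpr ⟨hk, ?_⟩)
    filter_upwards [Ioo_mem_nhdsLT (show (0 : ℝ) < 1 by norm_num)] with R hR
    have h1 : ‖circleMap 0 R θ‖ < 1 := by
      rw [norm_circleMap_zero, abs_of_pos hR.1]; exact hR.2
    have h2 : 0 ≤ (circleMap 0 R θ).im := by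
      simp only [circleMap, zero_add, Complex.im_ofReal_mul, Complex.exp_ofReal_mul_I_im]
      exact mul_nonneg hR.1.le (Real.sin_nonneg_of_nonneg_of_le_pi hθ.1.le hθ.2.le)
    have h3 := koebe_im_nonneg h1 h2
    simp only [Complex.add_im, Complex.one_im, zero_add, Complex.im_ofReal_mul]
    positivity
  · exact hk.clog (Or.inl (by rwa [Complex.ofReal_re]))

/-! ### An integrable majorant uniform in the radius. -/

/-- The numerator of `1 + a * koebe z`. -/
noncomputable def koebeNum (a : ℝ) (z : ℂ) : ℂ := (1 - z) ^ 2 + 4 * a * z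

theorem one_add_mul_koebe (a : ℝ) {z : ℂ} (hz : 1 - z ≠ 0) :
    1 + a * koebe z = koebeNum a z / (1 - z) ^ 2 := by
  unfold koebe koebeNum
  field_simp

/-- |1 - v| ≤ |1 - Rv| + (1 - R), and 1 - R is itself at most |1 - Rv|. -/
theorem norm_one_sub_div_two_le {v : ℂ} (hv : ‖v‖ = 1) {R : ℝ} (hR : 0 ≤ R) (hR1 : R ≤ 1) :
    ‖1 - v‖ / 2 ≤ ‖1 - R * v‖ := by
  have h1 : ‖(R : ℂ) * v‖ = R := by rw [norm_mul, hv, Complex.norm_real, Real.norm_of_nonneg hR, mul_one]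
  have h2 : 1 - R ≤ ‖1 - R * v‖ := by
    have := norm_sub_norm_le (1 : ℂ) (R * v)
    rwa [h1, norm_one] at this
  have h3 : ‖1 - v‖ ≤ ‖1 - R * v‖ + ‖((R - 1 : ℝ) : ℂ) * v‖ := by
    refine le_trans (le_of_eq ?_) (norm_add_le _ _)
    congr 1; push_cast; ring
  rw [norm_mul, hv, Complex.norm_real, Real.norm_of_nonpos (by linarith)] at h3
  linarith

/-- The numerator is z² - (2 - 4a)z + 1, whose roots are the conjugate pair 1 - 2a ± 2i√(a(1 - a))
of modulus 1. Each linear factor can then be compared radially with its value on the circle. -/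
theorem exists_koebeNum_factorization {a : ℝ} (ha : 0 ≤ a) (ha1 : a ≤ 1) :
    ∃ c d : ℂ, ‖c‖ = 1 ∧ ‖d‖ = 1 ∧ ∀ z, koebeNum a z = (1 - c * z) * (1 - d * z) := by
  set s := Real.sqrt (a * (1 - a)) with hs
  have hs2 : s ^ 2 = a * (1 - a) := Real.sq_sqrt (mul_nonneg ha (by linarith))
  have hs2' : (s : ℂ) ^ 2 = a * (1 - a) := by exact_mod_cast hs2
  refine ⟨⟨1 - 2 * a, 2 * s⟩, ⟨1 - 2 * a, -(2 * s)⟩, ?_, ?_, ?_⟩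
  · rw [Complex.norm_def, Complex.normSq_mk, Real.sqrt_eq_one]; nlinarith
  · rw [Complex.norm_def, Complex.normSq_mk, Real.sqrt_eq_one]; nlinarith
  · intro z
    have h1 : (⟨1 - 2 * a, 2 * s⟩ : ℂ) = 1 - 2 * a + 2 * s * Complex.I := by
      apply Complex.ext <;> simp
    have h2 : (⟨1 - 2 * a, -(2 * s)⟩ : ℂ) = 1 - 2 * a - 2 * s * Complex.I := by
      apply Complex.ext <;> simp
    rw [h1, h2, koebeNum]
    linear_combination (4 * (s : ℂ) ^ 2 * z ^ 2) * Complex.I_sq - 4 * z ^ 2 * hs2'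

theorem norm_koebeNum_radial {a : ℝ} (ha : 0 ≤ a) (ha1 : a ≤ 1) {v : ℂ} (hv : ‖v‖ = 1) {R : ℝ}
    (hR : 0 ≤ R) (hR1 : R ≤ 1) :
    ‖koebeNum a v‖ / 4 ≤ ‖koebeNum a (R * v)‖ ∧ ‖koebeNum a (R * v)‖ ≤ 4 := by
  obtain ⟨c, d, hc, hd, h⟩ := exists_koebeNum_factorization ha ha1
  have key : ∀ e : ℂ, ‖e‖ = 1 →
      ‖1 - e * v‖ / 2 ≤ ‖1 - e * (R * v)‖ ∧ ‖1 - e * (R * v)‖ ≤ 2 := by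
    intro e he
    constructor
    · have := norm_one_sub_div_two_le (v := e * v) (by rw [norm_mul, he, hv, mul_one]) hR hR1
      rwa [show (R : ℂ) * (e * v) = e * (R * v) by ring] at this
    · refine (norm_sub_le _ _).trans ?_
      rw [norm_one, norm_mul, norm_mul, he, hv, Complex.norm_real, Real.norm_of_nonneg hR]
      linarith
  rw [h, h, norm_mul, norm_mul]
  obtain ⟨c1, c2⟩ := key c hc
  obtain ⟨d1, d2⟩ := key d hd
  constructor
  · have := mul_le_mul c1 d1 (by positivity) (norm_nonneg _)
    linarith
  · have := mul_le_mul c2 d2 (norm_nonneg _) (by norm_num)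
    linarith

theorem abs_log_le_of_mem {x y : ℝ} (hy : 0 < y) (h1 : y / 4 ≤ x) (h2 : x ≤ 4) :
    |Real.log x| ≤ Real.log 4 + |Real.log y| := by
  have hx : 0 < x := lt_of_lt_of_le (by positivity) h1
  have h3 := Real.log_le_log hx h2
  have h4 := Real.log_le_log (by positivity) h1
  rw [Real.log_div hy.ne' (by norm_num)] at h4
  rw [abs_le]
  constructor
  · linarith [neg_abs_le (Real.log y)]
  · linarith [abs_nonneg (Real.log y)]

theorem norm_complex_log_le (w : ℂ) : ‖Complex.log w‖ ≤ |Real.log ‖w‖| + Real.pi := by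
  refine (Complex.norm_le_abs_re_add_abs_im _).trans ?_
  rw [Complex.log_re, Complex.log_im]
  gcongr
  exact Complex.abs_arg_le_pi w

theorem norm_koebeLog_le {a : ℝ} (ha : 0 ≤ a) (ha1 : a ≤ 1) {v : ℂ} (hv : ‖v‖ = 1) (hv1 : 1 - v ≠ 0)
    (hnum : koebeNum a v ≠ 0) {R : ℝ} (hR : 0 ≤ R) (hR1 : R < 1) :
    ‖koebeLog a (R * v)‖ ≤ 3 * Real.log 4 + Real.pi + |Real.log ‖koebeNum a v‖|
      + 2 * |Real.log ‖1 - v‖| := by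
  have hlt : ‖(R : ℂ) * v‖ < 1 := by
    rwa [norm_mul, hv, Complex.norm_real, Real.norm_of_nonneg hR, mul_one]
  have hz := one_sub_ne_zero_of_norm_lt hlt
  have hn1 : 0 < ‖1 - v‖ := norm_pos_iff.mpr hv1
  have hn2 : 0 < ‖koebeNum a v‖ := norm_pos_iff.mpr hnum
  obtain ⟨q1, q2⟩ := norm_koebeNum_radial ha ha1 hv hR hR1.le
  have o1 := norm_one_sub_div_two_le hv hR hR1.le
  have o2 : ‖1 - R * v‖ ≤ 2 := (norm_sub_le _ _).trans (by rw [norm_one]; linarith)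
  have l1 := abs_log_le_of_mem hn2 q1 q2
  have l2 := abs_log_le_of_mem hn1 (x := ‖1 - R * v‖) (by linarith) (by linarith)
  refine (norm_complex_log_le _).trans ?_
  have hq0 : ‖koebeNum a (R * v)‖ ≠ 0 := (lt_of_lt_of_le (by positivity) q1).ne'
  rw [one_add_mul_koebe a hz, norm_div, norm_pow, Real.log_div hq0 (by simpa using hz), Real.log_pow]
  have h3 := abs_sub (Real.log ‖koebeNum a (R * v)‖) ((2 : ℕ) * Real.log ‖1 - R * v‖)
  rw [abs_mul] at h3
  simp only [Nat.cast_ofNat, Nat.abs_ofNat] at h3 ⊢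
  linarith

/-- Zeros of f on the circle only produce integrable logarithmic singularities. -/
theorem integrableOn_log_norm_circle {f : ℂ → ℂ} (hf : Differentiable ℂ f) :
    IntegrableOn (fun θ => |Real.log ‖f (circleMap 0 1 θ)‖|) (Ioo 0 Real.pi) := by
  have h : CircleIntegrable (fun z => Real.log ‖f z‖) 0 1 :=
    MeromorphicOn.circleIntegrable_log_norm (fun z _ => (hf.analyticAt z).meromorphicAt)
  have h1 := h.1
  refine (IntegrableOn.mono_set h1 ?_).abs
  intro θ hθ
  exact ⟨hθ.1, by linarith [hθ.2, Real.pi_pos]⟩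

/-- Applied with c = 1 - 2a, this discards the angle at which 1 + a·koebe vanishes on the circle. -/
theorem ae_cos_ne (c : ℝ) : ∀ᵐ θ ∂volume.restrict (Ioo 0 Real.pi), Real.cos θ ≠ c := by
  rw [ae_restrict_iff' measurableSet_Ioo, ae_iff]
  refine Set.Countable.measure_zero (Set.Subsingleton.countable ?_) _
  intro x hx y hy
  simp only [mem_ofPred_eq, not_forall, not_not] at hx hy
  obtain ⟨hx, hx'⟩ := hx
  obtain ⟨hy, hy'⟩ := hy
  exact Real.injOn_cos ⟨hx.1.le, hx.2.le⟩ ⟨hy.1.le, hy.2.le⟩ (hx'.trans hy'.symm)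

theorem koebeNum_circleMap_ne_zero {a θ : ℝ} (h : Real.cos θ ≠ 1 - 2 * a) :
    koebeNum a (circleMap 0 1 θ) ≠ 0 := by
  have h2 : circleMap 0 1 θ ≠ 0 := circleMap_ne_center one_ne_zero
  have h3 : koebeNum a (circleMap 0 1 θ) =
      ((4 * a - 2 * (1 - Real.cos θ) : ℝ) : ℂ) * circleMap 0 1 θ := by
    rw [koebeNum, one_sub_circleMap_sq]
    push_cast
    ring
  rw [h3]
  refine mul_ne_zero (Complex.ofReal_ne_zero.mpr fun h0 => h ?_) h2
  linarith

theorem one_sub_mul_ne_zero {a θ : ℝ} (hθ : θ ∈ Ioo 0 Real.pi) (h : Real.cos θ ≠ 1 - 2 * a) :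
    1 - a * (2 / (1 - Real.cos θ)) ≠ 0 := by
  have := one_sub_cos_pos hθ
  intro h0
  field_simp at h0
  apply h
  linarith

/-! ### The integral representation on the positive axis. -/

/-- The boundary values of `log (1 + a w) / log (1 + b w)` on the upper side of the cut, at
`w = -2 / (1 - cos θ)`. -/
noncomputable def boundaryRatio (a b θ : ℝ) : ℂ :=
  Complex.log (1 - a * (2 / (1 - Real.cos θ)) : ℝ) /
    Complex.log (1 - b * (2 / (1 - Real.cos θ)) : ℝ)

theorem measurable_boundaryRatio (a b : ℝ) : Measurable (boundaryRatio a b) := by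
  unfold boundaryRatio
  refine Measurable.div (Complex.measurable_log.comp ?_) (Complex.measurable_log.comp ?_) <;>
  · refine Complex.measurable_ofReal.comp ?_
    have := Real.measurable_cos
    fun_prop

theorem koebe_inverse {x : ℝ} (hx : 0 < x) : ∃ p : ℝ, 0 < p ∧ p < 1 ∧ x = 4 * p / (1 - p) ^ 2 := by
  set s := Real.sqrt (1 + x) with hs
  have h2 : s ^ 2 = 1 + x := Real.sq_sqrt (by linarith)
  have h1 : 1 < s := by
    rw [hs, Real.lt_sqrt (by norm_num)]; linarith
  -- The witness solves 1 + x = ((1 + p)/(1 - p))².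
  refine ⟨(s - 1) / (s + 1), div_pos (by linarith) (by linarith),
    (div_lt_one (by linarith)).mpr (by linarith), ?_⟩
  have h3 : 1 - (s - 1) / (s + 1) = 2 / (s + 1) := by
    have : s + 1 ≠ 0 := by linarith
    field_simp; ring
  rw [h3]
  have : s + 1 ≠ 0 := by linarith
  field_simp
  nlinarith

theorem koebeRatio_ofReal {a b p : ℝ} (ha : 0 < a) (hb : 0 < b) (hp : 0 < p) (hp1 : p < 1) :
    koebeRatio a b p = (Real.log (1 + a * (4 * p / (1 - p) ^ 2)) /
      Real.log (1 + b * (4 * p / (1 - p) ^ 2)) : ℝ) := by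
  have h1 : 0 < 1 - p := by linarith
  have h2 : koebe p = ((4 * p / (1 - p) ^ 2 : ℝ) : ℂ) := by rw [koebe]; push_cast; ring
  have h3 : 0 < 4 * p / (1 - p) ^ 2 := by positivity
  rw [koebeRatio_of_ne (by exact_mod_cast hp.ne'), koebeLog, koebeLog, h2]
  push_cast [Complex.ofReal_log (show 0 ≤ 1 + a * (4 * p / (1 - p) ^ 2) by positivity),
    Complex.ofReal_log (show 0 ≤ 1 + b * (4 * p / (1 - p) ^ 2) by positivity)]
  rfl

open Filter Topology in
/-- The Stieltjes-type representation of a quotient of logarithms; the cut is parametrized by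
`t = 2 / (1 - cos θ)`. -/
theorem log_div_log_representation {a b : ℝ} (ha : 0 < a) (ha1 : a ≤ 1) (hb : 0 < b) (hb1 : b ≤ 1)
    {x : ℝ} (hx : 0 < x) :
    IntegrableOn (fun θ => (boundaryRatio a b θ).im * (Real.sin θ / (1 - Real.cos θ)) *
        (x / (x + 2 / (1 - Real.cos θ)))) (Ioo 0 Real.pi) ∧
      Real.log (1 + a * x) / Real.log (1 + b * x) = a / b + 1 / Real.pi *
        ∫ θ in Ioo 0 Real.pi, (boundaryRatio a b θ).im * (Real.sin θ / (1 - Real.cos θ)) *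
          (x / (x + 2 / (1 - Real.cos θ))) := by
  obtain ⟨p, hp, hp1, rfl⟩ := koebe_inverse hx
  set C := 3 * Real.log 4 + Real.pi
  have hcm : ∀ R θ : ℝ, circleMap 0 R θ = R * circleMap 0 1 θ := by
    intro R θ; simp [circleMap]
  have key := re_sub_re_eq_integral_boundary_im (F := koebeRatio a b) (Fb := boundaryRatio a b)
    (B := fun θ => (C + |Real.log ‖koebeNum a (circleMap 0 1 θ)‖|
      + 2 * |Real.log ‖1 - circleMap 0 1 θ‖|) * (4 / b))
    (differentiableOn_koebeRatio ha.le ha1 hb hb1)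
    (fun z hz => koebeRatio_conj ha.le ha1 hb.le hb1 (by simpa using hz))
    (measurable_boundaryRatio a b).aestronglyMeasurable
    (by
      have h1 := integrableOn_log_norm_circle (f := koebeNum a) (by unfold koebeNum; fun_prop)
      have h2 := integrableOn_log_norm_circle (f := fun z => 1 - z) (by fun_prop)
      have h0 : IntegrableOn (fun _ => C) (Ioo 0 Real.pi) :=
        integrableOn_const (by simp) (by simp)
      exact ((h0.add h1).add (h2.const_mul 2)).mul_const _)
    (by
      intro R hR hR1
      filter_upwards [ae_cos_ne (1 - 2 * a), ae_restrict_mem measurableSet_Ioo] with θ hθ hmem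
      have hR0 : 0 < R := by linarith
      have hn : ‖circleMap 0 R θ‖ = R := by rw [norm_circleMap_zero, abs_of_pos hR0]
      have h1 : koebeLog a (circleMap 0 R θ) = koebeLog a (R * circleMap 0 1 θ) := by rw [← hcm]
      rw [koebeRatio_of_ne (circleMap_ne_center hR0.ne'), norm_div, h1]
      have h2 := norm_koebeLog_le ha.le ha1 (v := circleMap 0 1 θ) (by simp)
        (one_sub_circleMap_ne_zero hmem) (koebeNum_circleMap_ne_zero hθ) hR0.le hR1
      have h3 := le_norm_koebeLog hb.le hb1 (z := circleMap 0 R θ) (by rwa [hn])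
      rw [hn] at h3
      -- Uses R ≥ 1/2 in the lower bound bR/2.
      have h4 : b / 4 ≤ ‖koebeLog b (circleMap 0 R θ)‖ := by nlinarith
      have h5 : 0 < b / 4 := by positivity
      refine (div_le_div₀ ((norm_nonneg _).trans h2) h2 h5 h4).trans (le_of_eq ?_)
      rw [div_div_eq_mul_div, mul_div_assoc])
    (by
      filter_upwards [ae_cos_ne (1 - 2 * a), ae_cos_ne (1 - 2 * b),
        ae_restrict_mem measurableSet_Ioo] with θ hθ hθ' hmem
      have h1 := tendsto_koebeLog_circleMap ha.le hmem (one_sub_mul_ne_zero hmem hθ)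
      have h2 := tendsto_koebeLog_circleMap hb.le hmem (one_sub_mul_ne_zero hmem hθ')
      have hne : Complex.log (1 - b * (2 / (1 - Real.cos θ)) : ℝ) ≠ 0 := by
        intro h0
        have h3 := Complex.exp_log (Complex.ofReal_ne_zero.mpr (one_sub_mul_ne_zero hmem hθ'))
        rw [h0, Complex.exp_zero] at h3
        have h4 : (1 : ℝ) = 1 - b * (2 / (1 - Real.cos θ)) := by exact_mod_cast h3
        have h5 := one_sub_cos_pos hmem
        have : 0 < b * (2 / (1 - Real.cos θ)) := by positivity
        linarith
      refine (h1.div h2 hne).congr' ?_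
      filter_upwards [Ioo_mem_nhdsLT (show (0 : ℝ) < 1 by norm_num)] with R hR
      exact (koebeRatio_of_ne (circleMap_ne_center hR.1.ne')).symm)
    hp hp1
  have hp0 : 0 < 1 - p := by linarith
  -- Change of variables x = 4p/(1 - p)², t = 2/(1 - cos θ): the conjugate Poisson kernel factors as
  -- sin θ/(1 - cos θ) times x/(x + t).
  have hker : ∀ θ ∈ Ioo 0 Real.pi, (boundaryRatio a b θ).im *
      (2 * p * Real.sin θ / (1 - 2 * p * Real.cos θ + p ^ 2)) =
      (boundaryRatio a b θ).im * (Real.sin θ / (1 - Real.cos θ)) *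
        (4 * p / (1 - p) ^ 2 / (4 * p / (1 - p) ^ 2 + 2 / (1 - Real.cos θ))) := by
    intro θ hθ
    have h1 := one_sub_cos_pos hθ
    have h2 : 0 < 1 - 2 * p * Real.cos θ + p ^ 2 := by nlinarith
    rw [mul_assoc (boundaryRatio a b θ).im]
    congr 1
    have h3 : 4 * p / (1 - p) ^ 2 + 2 / (1 - Real.cos θ) =
        2 * (1 - 2 * p * Real.cos θ + p ^ 2) / ((1 - p) ^ 2 * (1 - Real.cos θ)) := by
      field_simp; ring
    rw [h3]
    field_simp
    ring
  rw [koebeRatio_ofReal ha hb hp hp1, koebeRatio_zero, Complex.ofReal_re, Complex.ofReal_re] at key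
  rw [integrableOn_congr_fun hker measurableSet_Ioo,
    setIntegral_congr_fun measurableSet_Ioo hker] at key
  exact ⟨key.1, by linarith [key.2]⟩

/-! ### From a finite measure to the complete Bernstein and Stieltjes classes. -/

open ProbabilityTheory in
theorem Ioi_subset_interior_integrableExpSet {κ : Measure ℝ} [IsFiniteMeasure κ]
    (hκ : ∀ᵐ t ∂κ, 0 < t) : Ioi 0 ⊆ interior (integrableExpSet (fun t => -t) κ) := by
  refine interior_maximal (fun s hs => ?_) isOpen_Ioi
  refine Integrable.of_bound (C := 1) (by fun_prop) ?_
  filter_upwards [hκ] with t ht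
  rw [Real.norm_of_nonneg (Real.exp_nonneg _), Real.exp_le_one_iff]
  have : 0 < s * t := mul_pos hs ht
  linarith

-- This `mgf` is the Laplace transform of κ; its n-th derivative brings down (-t)^n, and t > 0
-- almost everywhere.
open ProbabilityTheory in
theorem isCompletelyMonotone_mgf_neg {κ : Measure ℝ} [IsFiniteMeasure κ]
    (hκ : ∀ᵐ t ∂κ, 0 < t) : IsCompletelyMonotone (mgf (fun t => -t) κ) := by
  have hsub := Ioi_subset_interior_integrableExpSet hκ
  refine ⟨(analyticOnNhd_mgf.mono hsub).contDiffOn (uniqueDiffOn_Ioi 0), fun n s hs => ?_⟩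
  rw [iteratedDeriv_mgf (hsub hs), ← integral_const_mul]
  refine integral_nonneg_of_ae ?_
  filter_upwards [hκ] with t ht
  rw [← mul_assoc, ← mul_pow]
  simp only [Pi.zero_apply, neg_mul_neg, one_mul]
  positivity

theorem IsCompletelyMonotone.neg_deriv {f : ℝ → ℝ} (hf : IsCompletelyMonotone f) :
    IsCompletelyMonotone (fun s => -deriv f s) := by
  refine ⟨(hf.1.deriv_of_isOpen isOpen_Ioi le_rfl).neg, fun n s hs => ?_⟩
  have h := hf.2 (n + 1) s hs
  rw [iteratedDeriv_succ', pow_succ] at h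
  rw [iteratedDeriv_fun_neg]
  linarith

theorem IsCompletelyMonotone.isBernstein_const_sub {f g : ℝ → ℝ} {c : ℝ}
    (hf : IsCompletelyMonotone f) (hg : ∀ x, 0 < x → g x = c - f x) (hg0 : ∀ x, 0 < x → 0 ≤ g x) :
    IsBernstein g := by
  refine ⟨(contDiffOn_const.sub hf.1).congr hg, hg0, fun n hn x hx => ?_⟩
  obtain ⟨k, rfl⟩ := Nat.exists_eq_add_of_le' hn
  have heq : g =ᶠ[nhds x] fun y => c - f y := by
    filter_upwards [Ioi_mem_nhds hx] with y hy using hg y hy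
  have h := hf.2 (k + 1) x hx
  rw [heq.iteratedDeriv_eq, iteratedDeriv_succ', Nat.add_sub_cancel]
  rw [iteratedDeriv_succ', pow_succ] at h
  have h2 : deriv (fun y => c - f y) = fun y => -deriv f y := by
    funext y; rw [deriv_const_sub]
  rw [h2, iteratedDeriv_fun_neg]
  linarith

theorem integral_Ioi_mul_exp_neg_mul {t : ℝ} (ht : 0 < t) :
    IntegrableOn (fun s => t * Real.exp (-(s * t))) (Ioi 0) ∧
      ∫ s in Ioi 0, t * Real.exp (-(s * t)) = 1 := by
  have h1 := integrableOn_exp_mul_Ioi (a := -t) (by linarith) 0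
  have h2 := integral_exp_mul_Ioi (a := -t) (by linarith) 0
  have he : ∀ s, Real.exp (-(s * t)) = Real.exp (-t * s) := fun s => by congr 1; ring
  simp only [he]
  refine ⟨h1.const_mul t, ?_⟩
  rw [integral_const_mul, h2]
  simp
  field_simp

theorem integral_Ioi_one_sub_exp_mul {t x : ℝ} (ht : 0 < t) (hx : 0 < x) :
    ∫ s in Ioi 0, (1 - Real.exp (-(x * s))) * (t * Real.exp (-(s * t))) = x / (x + t) := by
  obtain ⟨i1, e1⟩ := integral_Ioi_mul_exp_neg_mul ht
  obtain ⟨i2, e2⟩ := integral_Ioi_mul_exp_neg_mul (add_pos hx ht)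
  have he : ∀ s, (1 - Real.exp (-(x * s))) * (t * Real.exp (-(s * t))) =
      t * Real.exp (-(s * t)) - t / (x + t) * ((x + t) * Real.exp (-(s * (x + t)))) := by
    intro s
    have h1 : Real.exp (-(s * (x + t))) = Real.exp (-(x * s)) * Real.exp (-(s * t)) := by
      rw [← Real.exp_add]; congr 1; ring
    rw [h1]
    have : x + t ≠ 0 := by linarith
    field_simp
  simp only [he]
  rw [integral_sub i1 (i2.const_mul _), integral_const_mul (t / (x + t)), e1, e2]
  have : x + t ≠ 0 := by linarith
  field_simp
  ring

open ProbabilityTheory in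
theorem isCompleteBernstein_of_representation {f : ℝ → ℝ} {a : ℝ} (ha : 0 ≤ a) {κ : Measure ℝ}
    [IsFiniteMeasure κ] (hκ : ∀ᵐ t ∂κ, 0 < t)
    (hf : ∀ x, 0 < x → f x = a + ∫ t, x / (x + t) ∂κ) : IsCompleteBernstein f := by
  set m : ℝ → ℝ := fun s => -deriv (mgf (fun t => -t) κ) s with hm
  have hmcm : IsCompletelyMonotone m := (isCompletelyMonotone_mgf_neg hκ).neg_deriv
  have hm0 : ∀ s, 0 < s → 0 ≤ m s := fun s hs => by simpa using hmcm.2 0 s hs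
  have hmeq : ∀ s, 0 < s → m s = ∫ t, t * Real.exp (-(s * t)) ∂κ := by
    intro s hs
    rw [hm]
    simp only
    rw [deriv_mgf (Ioi_subset_interior_integrableExpSet hκ hs), ← integral_neg]
    refine integral_congr_ae (Filter.Eventually.of_forall fun t => ?_)
    simp
  -- Each t e^(-st) has s-integral 1, so finiteness of κ gives joint integrability. This yields
  -- integrability of m on (0, ∞) and justifies Fubini below.
  have hprod : Integrable (fun q : ℝ × ℝ => q.1 * Real.exp (-(q.2 * q.1)))
      (κ.prod (volume.restrict (Ioi 0))) := by
    rw [integrable_prod_iff (by fun_prop)]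
    refine ⟨?_, ?_⟩
    · filter_upwards [hκ] with t ht using (integral_Ioi_mul_exp_neg_mul ht).1
    · refine (integrable_const (1 : ℝ)).congr ?_
      filter_upwards [hκ] with t ht
      rw [← (integral_Ioi_mul_exp_neg_mul ht).2]
      refine integral_congr_ae (Filter.Eventually.of_forall fun s => ?_)
      exact (Real.norm_of_nonneg (mul_nonneg ht.le (Real.exp_nonneg _))).symm
  have hmint : IntegrableOn m (Ioi 0) := by
    refine (hprod.integral_prod_right).congr ?_
    filter_upwards [ae_restrict_mem measurableSet_Ioi] with s hs
    exact (hmeq s hs).symm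
  have hexp : ∀ x : ℝ, 0 < x → ∀ᵐ s ∂volume.restrict (Ioi 0), ‖Real.exp (-(x * s))‖ ≤ 1 := by
    intro x hx
    filter_upwards [ae_restrict_mem measurableSet_Ioi] with s hs
    rw [Real.norm_of_nonneg (Real.exp_nonneg _), Real.exp_le_one_iff]
    have : 0 < x * s := mul_pos hx hs
    linarith
  have hrep : ∀ x, 0 < x →
      f x = a + ∫ s in Ioi 0, (1 - Real.exp (-(x * s))) * m s := by
    intro x hx
    rw [hf x hx]
    congr 1
    have hprod2 : Integrable
        (fun q : ℝ × ℝ => (1 - Real.exp (-(x * q.2))) * (q.1 * Real.exp (-(q.2 * q.1))))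
        (κ.prod (volume.restrict (Ioi 0))) := by
      refine hprod.bdd_mul (c := 1) (by fun_prop) ?_
      have : ∀ᵐ q : ℝ × ℝ ∂κ.prod (volume.restrict (Ioi 0)), q.2 ∈ Ioi (0 : ℝ) :=
        Measure.quasiMeasurePreserving_snd.ae (ae_restrict_mem measurableSet_Ioi)
      filter_upwards [this] with q hq
      have h1 : Real.exp (-(x * q.2)) ≤ 1 := by
        rw [Real.exp_le_one_iff]
        have : 0 < x * q.2 := mul_pos hx hq
        linarith
      rw [Real.norm_of_nonneg (by linarith)]
      linarith [Real.exp_nonneg (-(x * q.2))]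
    have hswap := integral_integral_swap
      (f := fun t s => (1 - Real.exp (-(x * s))) * (t * Real.exp (-(s * t)))) hprod2
    have h1 : ∫ t, x / (x + t) ∂κ = ∫ t, (∫ s in Ioi 0,
        (1 - Real.exp (-(x * s))) * (t * Real.exp (-(s * t)))) ∂κ := by
      refine integral_congr_ae ?_
      filter_upwards [hκ] with t ht using (integral_Ioi_one_sub_exp_mul ht hx).symm
    rw [h1, hswap]
    refine setIntegral_congr_fun measurableSet_Ioi fun s hs => ?_
    rw [integral_const_mul, hmeq s hs]
  refine ⟨?_, a, 0, m, ha, le_rfl, hmcm, ?_, fun x hx => by rw [hrep x hx]; ring⟩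
  -- As m is integrable, m(s) ds is a finite measure σ, and f is the constant a + ∫ m minus the
  -- Laplace transform of σ.
  · set σ := (volume.restrict (Ioi (0 : ℝ))).withDensity (fun s => ENNReal.ofReal (m s)) with hσ
    have : IsFiniteMeasure σ := isFiniteMeasure_withDensity_ofReal hmint.2
    have hσpos : ∀ᵐ s ∂σ, 0 < s :=
      (withDensity_absolutelyContinuous _ _).ae_le (ae_restrict_mem measurableSet_Ioi)
    have hσint : ∀ x, mgf (fun t => -t) σ x = ∫ s in Ioi 0, Real.exp (-(x * s)) * m s := by
      intro x
      rw [mgf, hσ, integral_withDensity_eq_integral_toReal_smul₀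
        hmint.aestronglyMeasurable.aemeasurable.ennreal_ofReal (by simp)]
      refine setIntegral_congr_fun measurableSet_Ioi fun s hs => ?_
      change (ENNReal.ofReal (m s)).toReal • Real.exp (x * -s) = _
      rw [ENNReal.toReal_ofReal (hm0 s hs), smul_eq_mul, mul_comm, show x * -s = -(x * s) by ring]
    refine (isCompletelyMonotone_mgf_neg hσpos).isBernstein_const_sub
      (c := a + ∫ s in Ioi 0, m s) (fun x hx => ?_) (fun x hx => ?_)
    · rw [hrep x hx, hσint, add_sub_assoc, ← integral_sub hmint
        (hmint.bdd_mul (c := 1) (by fun_prop) (hexp x hx))]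
      congr 1
      refine integral_congr_ae (Filter.Eventually.of_forall fun s => ?_)
      simp only
      ring
    · rw [hf x hx]
      refine add_nonneg ha (integral_nonneg_of_ae ?_)
      filter_upwards [hκ] with t ht
      simp only [Pi.zero_apply]
      positivity
  · refine hmint.bdd_mul (c := 1) (by fun_prop) ?_
    filter_upwards [ae_restrict_mem measurableSet_Ioi] with s hs
    rw [Real.norm_of_nonneg (le_min zero_le_one (le_of_lt hs))]
    exact min_le_left _ _

theorem integrable_div_add {κ : Measure ℝ} [IsFiniteMeasure κ] (hκ : ∀ᵐ t ∂κ, 0 < t) {x : ℝ}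
    (hx : 0 < x) : Integrable (fun t => x / (x + t)) κ := by
  refine Integrable.of_bound (C := 1) (by fun_prop : Measurable _).aestronglyMeasurable ?_
  filter_upwards [hκ] with t ht
  rw [Real.norm_of_nonneg (by positivity), div_le_one (by positivity)]
  linarith

open Filter Topology in
theorem isStieltjes_of_representation {f : ℝ → ℝ} {c : ℝ} {κ : Measure ℝ}
    [IsFiniteMeasure κ] (hκ : ∀ᵐ t ∂κ, 0 < t)
    (hf : ∀ x, 0 < x → f x = c - ∫ t, x / (x + t) ∂κ) (hf0 : ∀ x, 0 < x → 0 ≤ f x) :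
    IsStieltjes f := by
  -- Let x = n + 1 → ∞ in ∫ x/(x + t) dκ ≤ c, which is f ≥ 0.
  have hc : κ.real univ ≤ c := by
    have hT := tendsto_integral_of_dominated_convergence (fun _ => (1 : ℝ)) (μ := κ)
      (F := fun (n : ℕ) t => ((n : ℝ) + 1) / ((n : ℝ) + 1 + t)) (f := fun _ => 1)
      (fun n => (by fun_prop : Measurable _).aestronglyMeasurable) (integrable_const 1)
      (fun n => by
        filter_upwards [hκ] with t ht
        rw [Real.norm_of_nonneg (by positivity), div_le_one (by positivity)]
        linarith)
      (by
        filter_upwards [hκ] with t ht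
        have h1 : Tendsto (fun n : ℕ => 1 - t / ((n : ℝ) + 1 + t)) atTop (𝓝 (1 - 0)) := by
          refine tendsto_const_nhds.sub (tendsto_const_nhds.div_atTop ?_)
          exact tendsto_atTop_add_const_right _ _
            (tendsto_atTop_add_const_right _ _ tendsto_natCast_atTop_atTop)
        rw [sub_zero] at h1
        refine h1.congr fun n => ?_
        have : (n : ℝ) + 1 + t ≠ 0 := by positivity
        field_simp
        ring)
    rw [integral_const, smul_eq_mul, mul_one] at hT
    refine le_of_tendsto hT (Eventually.of_forall fun n => ?_)
    have hn : (0 : ℝ) < n + 1 := by positivity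
    have := hf0 _ hn
    rw [hf _ hn] at this
    linarith
  have hae : ∀ᵐ t ∂κ, t ∈ Ici (0 : ℝ) := hκ.mono fun t ht => le_of_lt ht
  have hmeas : Measurable fun t : ℝ => ENNReal.ofReal t := ENNReal.measurable_ofReal
  refine ⟨c - κ.real univ, κ.withDensity ENNReal.ofReal, by linarith, fun x hx => ?_⟩
  have haed : ∀ᵐ t ∂κ.withDensity ENNReal.ofReal, t ∈ Ici (0 : ℝ) :=
    (withDensity_absolutelyContinuous _ _).ae_le hae
  have hpt : ∀ᵐ t ∂κ, (ENNReal.ofReal t).toReal • (1 / (x + t)) = 1 - x / (x + t) := by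
    filter_upwards [hκ] with t ht
    rw [ENNReal.toReal_ofReal ht.le, smul_eq_mul]
    have : x + t ≠ 0 := by positivity
    field_simp
    ring
  have hint := (integrable_const (1 : ℝ)).sub (integrable_div_add hκ hx)
  rw [IntegrableOn, Measure.restrict_eq_self_of_ae_mem haed]
  constructor
  · rw [integrable_withDensity_iff_integrable_smul' hmeas (by simp)]
    exact hint.congr (hpt.mono fun t ht => ht.symm)
  · rw [integral_withDensity_eq_integral_toReal_smul hmeas (by simp), integral_congr_ae hpt,
      integral_sub (integrable_const 1) (integrable_div_add hκ hx), hf x hx, integral_const,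
      smul_eq_mul, mul_one]
    ring

/-! ### Sign of the boundary imaginary part. -/

/-- Since log s has imaginary part π, the expression is π(log|s| - log|u|) for u < 0 and -π log u
for 0 < u ≤ 1. At u = 0 it vanishes by the convention log 0 = 0. -/
theorem log_ofReal_cross_nonneg {s u : ℝ} (hs : s < 0) (hsu : s ≤ u) (hu : u ≤ 1) :
    0 ≤ (Complex.log u).im * (Complex.log s).re - (Complex.log u).re * (Complex.log s).im := by
  simp only [Complex.log_re, Complex.log_im, Complex.norm_real, Real.norm_eq_abs, Real.log_abs,
    Complex.arg_ofReal_of_neg hs]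
  rcases lt_trichotomy u 0 with h | rfl | h
  · rw [Complex.arg_ofReal_of_neg h]
    have h1 := Real.log_le_log (show 0 < -u by linarith) (show -u ≤ -s by linarith)
    rw [Real.log_neg_eq_log, Real.log_neg_eq_log] at h1
    nlinarith [Real.pi_pos]
  · simp
  · rw [Complex.arg_ofReal_of_nonneg h.le]
    have h1 := Real.log_nonpos h.le hu
    nlinarith [Real.pi_pos]

theorem im_div_eq_cross (z w : ℂ) : (z / w).im = (z.im * w.re - z.re * w.im) / Complex.normSq w := by
  rw [Complex.div_im]; ring

theorem one_lt_two_div_one_sub_cos {θ : ℝ} (hθ : θ ∈ Ioo 0 Real.pi) : 1 < 2 / (1 - Real.cos θ) := by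
  have h := one_sub_cos_pos hθ
  have h2 := Real.cos_lt_cos_of_nonneg_of_le_pi hθ.1.le le_rfl hθ.2
  rw [Real.cos_pi] at h2
  rw [lt_div_iff₀ h]
  linarith

theorem boundaryRatio_one_right_im_nonneg {r θ : ℝ} (hr : 0 ≤ r) (hr1 : r ≤ 1)
    (hθ : θ ∈ Ioo 0 Real.pi) : 0 ≤ (boundaryRatio r 1 θ).im := by
  have h := one_lt_two_div_one_sub_cos hθ
  rw [boundaryRatio, im_div_eq_cross]
  exact div_nonneg (log_ofReal_cross_nonneg (by linarith) (by nlinarith) (by nlinarith))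
    (Complex.normSq_nonneg _)

theorem boundaryRatio_one_left_im_nonpos {r θ : ℝ} (hr : 0 ≤ r) (hr1 : r ≤ 1)
    (hθ : θ ∈ Ioo 0 Real.pi) : (boundaryRatio 1 r θ).im ≤ 0 := by
  have h := one_lt_two_div_one_sub_cos hθ
  rw [boundaryRatio, im_div_eq_cross]
  refine div_nonpos_of_nonpos_of_nonneg ?_ (Complex.normSq_nonneg _)
  have := log_ofReal_cross_nonneg (s := 1 - 1 * (2 / (1 - Real.cos θ)))
    (u := 1 - r * (2 / (1 - Real.cos θ))) (by linarith) (by nlinarith) (by nlinarith)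
  linarith

/-! ### Finiteness of the representing measure. -/

-- Fatou's lemma along x = n + 1, where x/(x + τ) → 1.
open Filter Topology in
theorem integrable_of_integral_mul_div_add_le {α : Type*} [MeasurableSpace α] {μ : Measure α}
    {H τ : α → ℝ} (hH : AEMeasurable H μ) (hH0 : ∀ᵐ θ ∂μ, 0 ≤ H θ) (hτ0 : ∀ᵐ θ ∂μ, 0 < τ θ) {M : ℝ}
    (hint : ∀ x, 0 < x → Integrable (fun θ => H θ * (x / (x + τ θ))) μ)
    (hle : ∀ x, 0 < x → ∫ θ, H θ * (x / (x + τ θ)) ∂μ ≤ M) : Integrable H μ := by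
  refine ⟨hH.aestronglyMeasurable, ?_⟩
  rw [hasFiniteIntegral_iff_ofReal hH0]
  have hn : ∀ n : ℕ, (0 : ℝ) < n + 1 := fun n => by positivity
  have hlim : ∀ᵐ θ ∂μ, ENNReal.ofReal (H θ) = liminf (fun n : ℕ =>
      ENNReal.ofReal (H θ * (((n : ℝ) + 1) / ((n : ℝ) + 1 + τ θ)))) atTop := by
    filter_upwards [hτ0] with θ ht
    refine (Tendsto.liminf_eq (ENNReal.tendsto_ofReal ?_)).symm
    have h1 : Tendsto (fun n : ℕ => H θ * (1 - τ θ / ((n : ℝ) + 1 + τ θ))) atTop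
        (𝓝 (H θ * (1 - 0))) := by
      refine (tendsto_const_nhds.sub (tendsto_const_nhds.div_atTop ?_)).const_mul _
      exact tendsto_atTop_add_const_right _ _
        (tendsto_atTop_add_const_right _ _ tendsto_natCast_atTop_atTop)
    rw [sub_zero, mul_one] at h1
    refine h1.congr fun n => ?_
    have : (n : ℝ) + 1 + τ θ ≠ 0 := by positivity
    congr 1
    field_simp
    ring
  rw [lintegral_congr_ae hlim]
  refine lt_of_le_of_lt (lintegral_liminf_le' fun n =>
    (hint _ (hn n)).aestronglyMeasurable.aemeasurable.ennreal_ofReal) ?_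
  refine lt_of_le_of_lt (b := ENNReal.ofReal M) ?_ ENNReal.ofReal_lt_top
  refine liminf_le_of_frequently_le' (Frequently.of_forall fun n => ?_)
  rw [← ofReal_integral_eq_lintegral_ofReal (hint _ (hn n))]
  · exact ENNReal.ofReal_le_ofReal (hle _ (hn n))
  · filter_upwards [hH0, hτ0] with θ h1 h2
    have := hn n
    simp only [Pi.zero_apply]
    positivity

theorem exists_isFiniteMeasure_of_integral_le {α : Type*} [MeasurableSpace α] {μ : Measure α}
    {H τ : α → ℝ} (hH : AEMeasurable H μ) (hH0 : ∀ᵐ θ ∂μ, 0 ≤ H θ) (hτ : Measurable τ)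
    (hτ0 : ∀ᵐ θ ∂μ, 0 < τ θ) {M : ℝ}
    (hint : ∀ x, 0 < x → Integrable (fun θ => H θ * (x / (x + τ θ))) μ)
    (hle : ∀ x, 0 < x → ∫ θ, H θ * (x / (x + τ θ)) ∂μ ≤ M) :
    ∃ κ : Measure ℝ, IsFiniteMeasure κ ∧ (∀ᵐ t ∂κ, 0 < t) ∧
      ∀ x, 0 < x → ∫ t, x / (x + t) ∂κ = ∫ θ, H θ * (x / (x + τ θ)) ∂μ := by
  have hHint := integrable_of_integral_mul_div_add_le hH hH0 hτ0 hint hle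
  have hfin : IsFiniteMeasure (μ.withDensity fun θ => ENNReal.ofReal (H θ)) :=
    isFiniteMeasure_withDensity_ofReal hHint.2
  refine ⟨(μ.withDensity fun θ => ENNReal.ofReal (H θ)).map τ, inferInstance, ?_, fun x hx => ?_⟩
  · rw [ae_map_iff hτ.aemeasurable measurableSet_Ioi]
    exact (withDensity_absolutelyContinuous _ _).ae_le hτ0
  · rw [integral_map hτ.aemeasurable (by fun_prop : Measurable _).aestronglyMeasurable,
      integral_withDensity_eq_integral_toReal_smul₀ hH.ennreal_ofReal (by simp)]
    refine integral_congr_ae ?_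
    filter_upwards [hH0] with θ h
    rw [ENNReal.toReal_ofReal h, smul_eq_mul]

/-! ### The two cases r < 1 and r > 1. -/

theorem isCompleteBernstein_logRatio {r : ℝ} (hr : 0 < r) (hr1 : r < 1) :
    IsCompleteBernstein (logRatio r) := by
  have hrep := fun x (hx : 0 < x) => log_div_log_representation hr hr1.le one_pos le_rfl hx
  set H : ℝ → ℝ := fun θ => 1 / Real.pi *
    ((boundaryRatio r 1 θ).im * (Real.sin θ / (1 - Real.cos θ))) with hHdef
  have hmul : ∀ x θ, H θ * (x / (x + 2 / (1 - Real.cos θ))) = 1 / Real.pi *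
      ((boundaryRatio r 1 θ).im * (Real.sin θ / (1 - Real.cos θ)) *
        (x / (x + 2 / (1 - Real.cos θ)))) := fun x θ => mul_assoc _ _ _
  have hf : ∀ x, 0 < x → logRatio r x = r +
      ∫ θ in Ioo 0 Real.pi, H θ * (x / (x + 2 / (1 - Real.cos θ))) := by
    intro x hx
    simp only [hmul]
    rw [integral_const_mul, logRatio]
    have := (hrep x hx).2
    rwa [div_one, one_mul] at this
  obtain ⟨κ, hκ, hκ0, hκint⟩ := exists_isFiniteMeasure_of_integral_le
    (μ := volume.restrict (Ioo 0 Real.pi)) (H := H) (τ := fun θ => 2 / (1 - Real.cos θ)) (M := 1)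
    (by
      have h1 := Complex.measurable_im.comp (measurable_boundaryRatio r 1)
      have h2 : Measurable fun θ => Real.sin θ / (1 - Real.cos θ) := by fun_prop
      exact ((h1.mul h2).const_mul (1 / Real.pi)).aemeasurable)
    (by
      filter_upwards [ae_restrict_mem measurableSet_Ioo] with θ hθ
      exact mul_nonneg (by positivity) (mul_nonneg
        (boundaryRatio_one_right_im_nonneg hr.le hr1.le hθ)
        (div_nonneg (Real.sin_nonneg_of_nonneg_of_le_pi hθ.1.le hθ.2.le) (one_sub_cos_pos hθ).le)))
    (by fun_prop)
    (by
      filter_upwards [ae_restrict_mem measurableSet_Ioo] with θ hθ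
      linarith [one_lt_two_div_one_sub_cos hθ])
    (fun x hx => by
      simp only [hmul]
      exact (hrep x hx).1.const_mul _)
    (fun x hx => by
      have h1 := hf x hx
      have h2 : logRatio r x ≤ 1 := by
        refine div_le_one_of_le₀ (Real.log_le_log (by positivity) (by nlinarith))
          (Real.log_nonneg (by linarith))
      linarith)
  exact isCompleteBernstein_of_representation hr.le hκ0 (fun x hx => by rw [hf x hx, hκint x hx])

theorem isStieltjes_logRatio {r : ℝ} (hr : 1 < r) : IsStieltjes (logRatio r) := by
  have hr0 : 0 < r := by linarith
  have hi0 : 0 < 1 / r := by positivity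
  have hi1 : 1 / r ≤ 1 := (div_le_one hr0).mpr hr.le
  -- Evaluating at rx with b = 1/r turns the denominator into log(1 + x) and keeps both parameters
  -- at most 1; the cut variable is then rescaled by 1/r.
  have hrep := fun x (hx : 0 < x) =>
    log_div_log_representation one_pos le_rfl hi0 hi1 (mul_pos hr0 hx)
  set τ : ℝ → ℝ := fun θ => 2 / (1 - Real.cos θ) / r with hτ
  set H : ℝ → ℝ := fun θ => -(1 / Real.pi) *
    ((boundaryRatio 1 (1 / r) θ).im * (Real.sin θ / (1 - Real.cos θ))) with hHdef
  have hmul : ∀ x θ, H θ * (x / (x + τ θ)) = -(1 / Real.pi) *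
      ((boundaryRatio 1 (1 / r) θ).im * (Real.sin θ / (1 - Real.cos θ)) *
        (r * x / (r * x + 2 / (1 - Real.cos θ)))) := by
    intro x θ
    have h1 : x / (x + τ θ) = r * x / (r * x + 2 / (1 - Real.cos θ)) := by
      rw [← mul_div_mul_left x (x + τ θ) hr0.ne', mul_add, hτ]
      simp only
      rw [mul_div_cancel₀ _ hr0.ne']
    rw [h1, hHdef, mul_assoc]
  have hf : ∀ x, 0 < x → logRatio r x = r -
      ∫ θ in Ioo 0 Real.pi, H θ * (x / (x + τ θ)) := by
    intro x hx
    simp only [hmul]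
    rw [integral_const_mul, logRatio]
    have := (hrep x hx).2
    rw [one_div_one_div, one_mul, ← mul_assoc, one_div_mul_cancel hr0.ne', one_mul] at this
    rw [this]
    ring
  have hf0 : ∀ x, 0 < x → 0 ≤ logRatio r x := fun x hx =>
    div_nonneg (Real.log_nonneg (by nlinarith)) (Real.log_nonneg (by linarith))
  obtain ⟨κ, hκ, hκ0, hκint⟩ := exists_isFiniteMeasure_of_integral_le
    (μ := volume.restrict (Ioo 0 Real.pi)) (H := H) (τ := τ) (M := r)
    (by
      have h1 := Complex.measurable_im.comp (measurable_boundaryRatio 1 (1 / r))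
      have h2 : Measurable fun θ => Real.sin θ / (1 - Real.cos θ) := by fun_prop
      exact ((h1.mul h2).const_mul (-(1 / Real.pi))).aemeasurable)
    (by
      filter_upwards [ae_restrict_mem measurableSet_Ioo] with θ hθ
      have h1 : 0 ≤ 1 / Real.pi := by positivity
      exact mul_nonneg_of_nonpos_of_nonpos (by linarith) (mul_nonpos_of_nonpos_of_nonneg
        (boundaryRatio_one_left_im_nonpos hi0.le hi1 hθ)
        (div_nonneg (Real.sin_nonneg_of_nonneg_of_le_pi hθ.1.le hθ.2.le) (one_sub_cos_pos hθ).le)))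
    (by fun_prop)
    (by
      filter_upwards [ae_restrict_mem measurableSet_Ioo] with θ hθ
      have := one_lt_two_div_one_sub_cos hθ
      exact div_pos (by linarith) hr0)
    (fun x hx => by
      simp only [hmul]
      exact (hrep x hx).1.const_mul _)
    (fun x hx => by linarith [hf x hx, hf0 x hx])
  exact isStieltjes_of_representation hκ0 (fun x hx => by rw [hf x hx, hκint x hx]) hf0

theorem theorem1 :
    (∀ r : ℝ, 0 < r → r < 1 → IsCompleteBernstein (logRatio r) ∧ IsBernstein (logRatio r)) ∧
      ∀ r : ℝ, 1 < r → IsStieltjes (logRatio r) := by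
  refine ⟨fun r hr hr1 => ?_, fun r hr => isStieltjes_logRatio hr⟩
  have h := isCompleteBernstein_logRatio hr hr1
  exact ⟨h, h.1⟩
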